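/- Let $N \ge 3$ be an integer, let $\zeta_N = e^{2\pi i/N}$, and for integers $k$ with $1 \le k < N/2$ let $s_k = \tan(k\pi/N)$. Call $s_k$ primitive if $\gcd(k,N)=1$ and degenerate if $\gcd(k,N)>1$. Then every degenerate $s_k$ is a linear combination, with rational coefficients, of the primitive $s_j$. Moreover, every $i\,s_k$ ($1 \le k < N/2$) lies in the $\mathbb{Q}$-vector space $\mathbb{Q}(\zeta_N)^- = \mathbb{Q}(\zeta_N) \cap i\mathbb{R}$, the numbers $i\,s_k$ with $1 \le k < N/2$ and $\gcd(k,N)=1$ form a basis of $\mathbb{Q}(\zeta_N)^-$ over $\mathbb{Q}$, and $\dim_{\mathbb{Q}} \mathbb{Q}(\zeta_N)^- = \varphi(N)/2$, where $\varphi$ is Euler's totient function. -/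

import Mathlib

/-- The star point `s_k = tan (k π / N)` of the regular `N`-gon. -/
noncomputable def starPoint (N k : ℕ) : ℝ :=
  Real.tan ((k : ℝ) * Real.pi / (N : ℝ))

/-- The indices of all star points of the regular `N`-gon: `1 ≤ k < N / 2`. -/
def starIndices (N : ℕ) : Finset ℕ :=
  (Finset.range N).filter (fun k => 1 ≤ k ∧ 2 * k < N)

/-- The indices `1 ≤ k < N / 2` with `gcd (k, N) = 1`: these give the primitive star points;
the star points with the other indices are the degenerate ones. -/
def primitiveIndices (N : ℕ) : Finset ℕ :=
  (starIndices N).filter (fun k => Nat.gcd k N = 1)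

/-- The cyclotomic field `ℚ(ζ_N)` as a subfield of `ℂ`, with `ζ_N = exp (2 π i / N)`. -/
noncomputable def cyclotomicSubfield (N : ℕ) : IntermediateField ℚ ℂ :=
  IntermediateField.adjoin ℚ {Complex.exp (2 * (Real.pi : ℂ) * Complex.I / (N : ℂ))}

/-- `ℚ(ζ_N)⁻ = ℚ(ζ_N) ∩ iℝ`, as a vector space over `ℚ`. -/
noncomputable def cyclotomicMinus (N : ℕ) : Submodule ℚ ℂ where
  carrier := {z | z ∈ cyclotomicSubfield N ∧ ∃ t : ℝ, z = Complex.I * (t : ℂ)}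
  zero_mem' := ⟨(cyclotomicSubfield N).zero_mem, 0, by simp⟩
  add_mem' := by
    rintro x y ⟨hx, s, rfl⟩ ⟨hy, t, rfl⟩
    exact ⟨(cyclotomicSubfield N).add_mem hx hy, s + t, by push_cast; ring⟩
  smul_mem' := by
    rintro c x ⟨hx, t, rfl⟩
    refine ⟨(cyclotomicSubfield N).smul_mem hx, (c : ℝ) * t, ?_⟩
    rw [Rat.smul_def]
    push_cast
    ring

/-!
Every `i s_k` is `(ζ ^ k - 1) / (ζ ^ k + 1)` with `ζ = exp (2 π i / N)`, so it lies in `ℚ(ζ)⁻`.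
Multiplication by `i s_1` maps `ℚ(ζ)⁻` injectively into the real numbers of `ℚ(ζ)`, hence
`2 dim ℚ(ζ)⁻ ≤ φ(N)` (`two_mul_finrank_cyclotomicMinus_le`). There are at least `φ(N) / 2` primitive
indices, so everything follows once the primitive `i s_k` are known to be linearly independent over
`ℚ` (`linearIndependent_I_mul_starPoint`).

For that, apply the automorphisms `ζ ↦ ζ ^ c` to a rational relation `∑ a_k tan (k π / N) = 0`. It
becomes `∑ a_k tan (c k π / N) = 0` for all units `c` mod `N`. Summing against a Dirichlet character
`χ⁻¹` separates the relation into a product: the sum `∑ a_k χ(k)` times the character sum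
`∑ χ⁻¹(c) tan (c π / N)`. If the second factor never vanishes for odd characters, then `∑ a_k χ(k)`
vanishes for odd `χ`, and since no two primitive indices are congruent up to sign, orthogonality of
characters gives `a = 0` (`eq_zero_of_forall_unit_sum_mul_eq_zero`).

The tangent sum reduces to the cotangent sum `∑ χ(c) cot (c π / N)`, by elementary identities that
depend on `N` mod `4`. By the partial fraction expansion of the cotangent, the value of the odd
Hurwitz zeta function at `1` is `hurwitzZetaOdd a 1 = (π / 2) cot (π a)`, so the cotangent sum is
a nonzero multiple of `L(1, χ)`, which is nonzero by Dirichlet's theorem.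
-/

/-! ### The odd Hurwitz zeta function at `1` -/

section

open Filter Topology

/-- A bound uniform in `1 ≤ s ≤ 2`, by the mean value theorem. It dominates the terms of the series
of `hurwitzZetaOdd a s` as `s` decreases to `1`. -/
lemma abs_rpow_neg_sub_rpow_neg_le {m x y s : ℝ} (hm : 0 < m) (hx : m ≤ x) (hy : m ≤ y)
    (hxy : |x - y| ≤ 1) (hs : s ∈ Set.Icc (1 : ℝ) 2) :
    |x ^ (-s) - y ^ (-s)| ≤ 2 * (m ^ (-2 : ℝ) + m ^ (-3 : ℝ)) := by
  have hs0 : 0 ≤ s := by linarith [hs.1]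
  have key : m ^ (-s - 1) ≤ m ^ (-2 : ℝ) + m ^ (-3 : ℝ) := by
    have h2 : 0 < m ^ (-2 : ℝ) := Real.rpow_pos_of_pos hm _
    have h3 : 0 < m ^ (-3 : ℝ) := Real.rpow_pos_of_pos hm _
    rcases le_total 1 m with h | h
    · have := Real.rpow_le_rpow_of_exponent_le h (show -s - 1 ≤ -2 by linarith [hs.1])
      linarith
    · have := Real.rpow_le_rpow_of_exponent_ge hm h (show -3 ≤ -s - 1 by linarith [hs.2])
      linarith
  have hmvt := (convex_Ici m).norm_image_sub_le_of_norm_hasDerivWithin_le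
    (f := fun t : ℝ => t ^ (-s)) (f' := fun t => -s * t ^ (-s - 1)) (C := s * m ^ (-s - 1))
    (fun t ht => (Real.hasDerivAt_rpow_const
      (Or.inl (hm.trans_le ht).ne')).hasDerivWithinAt)
    (fun t ht => by
      rw [norm_mul, norm_neg, Real.norm_of_nonneg hs0,
        Real.norm_of_nonneg (Real.rpow_nonneg (hm.le.trans ht) _)]
      exact mul_le_mul_of_nonneg_left
        (Real.rpow_le_rpow_of_nonpos hm ht (by linarith)) hs0) hy hx
  rw [Real.norm_eq_abs, Real.norm_eq_abs] at hmvt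
  have hp : 0 ≤ m ^ (-s - 1) := Real.rpow_nonneg hm.le _
  calc |x ^ (-s) - y ^ (-s)| ≤ s * m ^ (-s - 1) * |x - y| := hmvt
    _ ≤ s * m ^ (-s - 1) * 1 := by gcongr
    _ ≤ 2 * (m ^ (-2 : ℝ) + m ^ (-3 : ℝ)) := by
      rw [mul_one]
      exact mul_le_mul hs.2 key hp (by norm_num)

lemma summable_nat_add_rpow_neg {δ p : ℝ} (hδ : 0 < δ) (hp : 1 < p) :
    Summable fun n : ℕ => ((n : ℝ) + δ) ^ (-p) := by
  refine ((Real.summable_one_div_nat_add_rpow δ p).mpr hp).congr fun n => ?_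
  have : 0 < (n : ℝ) + δ := by positivity
  rw [abs_of_pos this, Real.rpow_neg this.le, one_div]

/-- The partial fraction expansion of the cotangent, with the terms grouped as in the series for
`hurwitzZetaOdd a s`. -/
lemma hasSum_inv_nat_add_sub_inv {a : ℝ} (ha : a ∈ Set.Ioo (0 : ℝ) 1) :
    HasSum (fun n : ℕ => ((n + a : ℝ)⁻¹ - (n + 1 - a : ℝ)⁻¹))
      (Real.pi * Real.cot (Real.pi * a)) := by
  obtain ⟨h0, h1⟩ := ha
  have hsum : Summable (fun n : ℕ => ((n + a : ℝ)⁻¹ - (n + 1 - a : ℝ)⁻¹)) := by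
    have hm : 0 < min a (1 - a) := lt_min h0 (by linarith)
    refine Summable.of_norm_bounded (g := fun n : ℕ =>
      2 * (((n : ℝ) + min a (1 - a)) ^ (-2 : ℝ) + ((n : ℝ) + min a (1 - a)) ^ (-3 : ℝ)))
      (((summable_nat_add_rpow_neg hm (by norm_num)).add
        (summable_nat_add_rpow_neg hm (by norm_num))).mul_left 2) fun n => ?_
    have := abs_rpow_neg_sub_rpow_neg_le (m := n + min a (1 - a)) (x := n + a) (y := n + 1 - a)
      (s := 1) (by positivity) (by linarith [min_le_left a (1 - a)])
      (by linarith [min_le_right a (1 - a)]) (by rw [abs_le]; constructor <;> linarith)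
      ⟨le_rfl, by norm_num⟩
    simpa only [Real.rpow_neg_one, Real.norm_eq_abs] using this
  have hint : (a : ℂ) ∈ Complex.integerComplement := by
    rintro ⟨n, hn⟩
    have hn' : (n : ℝ) = a := by exact_mod_cast hn
    have h2 : (0 : ℝ) < n := hn' ▸ h0
    have h3 : (n : ℝ) < 1 := hn' ▸ h1
    norm_cast at h2 h3
    omega
  have hlim := tendsto_logDeriv_euler_cot_sub hint
  rw [hsum.hasSum_iff_tendsto_nat]
  -- The two groupings of the terms differ by the boundary terms `1 / a` and `1 / (n - a)`.
  have hpart (n : ℕ) : ∑ i ∈ Finset.range n, ((i + a : ℝ)⁻¹ - (i + 1 - a : ℝ)⁻¹) =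
      (∑ j ∈ Finset.range n, (1 / (a - (j + 1)) + 1 / (a + (j + 1)))) + a⁻¹ - (n + a)⁻¹ := by
    induction n with
    | zero => simp
    | succ n ih =>
      rw [Finset.sum_range_succ, Finset.sum_range_succ, ih]
      have : (a - (n + 1))⁻¹ = - (n + 1 - a)⁻¹ := by rw [← inv_neg]; congr 1; ring
      rw [one_div, one_div, this]
      push_cast
      rw [show a + (n + 1) = n + 1 + a by ring]
      ring
  have hlimR : Tendsto (fun n : ℕ => ∑ j ∈ Finset.range n,
      (1 / (a - (j + 1)) + 1 / (a + (j + 1)))) atTop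
      (𝓝 (Real.pi * Real.cot (Real.pi * a) - 1 / a)) := by
    have := (Complex.continuous_re.tendsto _).comp hlim
    convert! this using 1
    · funext n
      simp only [Function.comp_apply, cotTerm]
      rw [← Complex.ofReal_re (∑ j ∈ Finset.range n, _)]
      push_cast
      rfl
    · rw [← Complex.ofReal_re (Real.pi * Real.cot (Real.pi * a) - 1 / a)]
      push_cast
      rfl
  have hz : Tendsto (fun n : ℕ => ((n : ℝ) + a)⁻¹) atTop (𝓝 0) :=
    (tendsto_atTop_add_const_right _ _ tendsto_natCast_atTop_atTop).inv_tendsto_atTop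
  simp_rw [hpart]
  convert! (hlimR.add_const a⁻¹).sub hz using 2
  ring

/-- The series for `hurwitzZetaOdd a s` is only known for `1 < re s`; the value at `1` follows by
dominated convergence as `s` tends to `1` along the reals. -/
lemma hurwitzZetaOdd_one {a : ℝ} (ha : a ∈ Set.Ioo (0 : ℝ) 1) :
    HurwitzZeta.hurwitzZetaOdd (a : UnitAddCircle) 1 =
      ((Real.pi / 2 * Real.cot (Real.pi * a) : ℝ) : ℂ) := by
  obtain ⟨h0, h1⟩ := ha
  have hm : 0 < min a (1 - a) := lt_min h0 (by linarith)
  have hlim1 : Tendsto (fun s : ℝ => HurwitzZeta.hurwitzZetaOdd (a : UnitAddCircle) (s : ℂ))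
      (𝓝[>] 1) (𝓝 (HurwitzZeta.hurwitzZetaOdd (a : UnitAddCircle) 1)) := by
    have hc := (HurwitzZeta.differentiable_hurwitzZetaOdd (a : UnitAddCircle)).continuous.comp
      Complex.continuous_ofReal
    have := (hc.tendsto (1 : ℝ)).mono_left (nhdsWithin_le_nhds (s := Set.Ioi 1))
    simpa using! this
  have hdom : Tendsto (fun s : ℝ => ∑' n : ℕ, ((n + a : ℝ) ^ (-s) - (n + 1 - a : ℝ) ^ (-s)))
      (𝓝[>] 1) (𝓝 (∑' n : ℕ, ((n + a : ℝ)⁻¹ - (n + 1 - a : ℝ)⁻¹))) := by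
    refine tendsto_tsum_of_dominated_convergence (bound := fun n : ℕ =>
      2 * (((n : ℝ) + min a (1 - a)) ^ (-2 : ℝ) + ((n : ℝ) + min a (1 - a)) ^ (-3 : ℝ)))
      (((summable_nat_add_rpow_neg hm (by norm_num)).add
        (summable_nat_add_rpow_neg hm (by norm_num))).mul_left 2) (fun n => ?_) ?_
    · have hp : 0 < (n : ℝ) + a := by positivity
      have hq : 0 < (n : ℝ) + 1 - a := by linarith [n.cast_nonneg (α := ℝ)]
      have hcont : Continuous fun s : ℝ => (n + a : ℝ) ^ (-s) - (n + 1 - a : ℝ) ^ (-s) :=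
        (continuous_const.rpow continuous_neg fun _ => Or.inl hp.ne').sub
          (continuous_const.rpow continuous_neg fun _ => Or.inl hq.ne')
      simpa only [Real.rpow_neg_one] using
        (hcont.tendsto 1).mono_left (nhdsWithin_le_nhds (s := Set.Ioi 1))
    · filter_upwards [Ioo_mem_nhdsGT (show (1 : ℝ) < 2 by norm_num)] with s hs n
      exact abs_rpow_neg_sub_rpow_neg_le (by positivity) (by linarith [min_le_left a (1 - a)])
        (by linarith [min_le_right a (1 - a)]) (by rw [abs_le]; constructor <;> linarith)
        ⟨hs.1.le, hs.2.le⟩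
  rw [(hasSum_inv_nat_add_sub_inv ⟨h0, h1⟩).tsum_eq] at hdom
  refine tendsto_nhds_unique hlim1 ?_
  have hdomC := (Complex.continuous_ofReal.tendsto _).comp (hdom.div_const 2)
  rw [show Real.pi / 2 * Real.cot (Real.pi * a) = Real.pi * Real.cot (Real.pi * a) / 2 by ring]
  refine hdomC.congr' ?_
  filter_upwards [self_mem_nhdsWithin] with s hs
  rw [← (HurwitzZeta.hasSum_nat_hurwitzZetaOdd_of_mem_Icc ⟨h0.le, h1.le⟩
    (show 1 < (s : ℂ).re from hs)).tsum_eq, Function.comp_apply, ← tsum_div_const,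
    Complex.ofReal_tsum]
  refine tsum_congr fun n => ?_
  have hp : 0 < (n : ℝ) + a := by positivity
  have hq : 0 < (n : ℝ) + 1 - a := by linarith [n.cast_nonneg (α := ℝ)]
  rw [Real.rpow_neg hp.le, Real.rpow_neg hq.le]
  push_cast [Complex.ofReal_cpow hp.le, Complex.ofReal_cpow hq.le]
  simp only [one_div]

end

/-- The function `j ↦ cot (π j / N)` on `ZMod N`, evaluated at the representative in `[0, N)`. Its
value at `0` is the junk value `0`. -/
noncomputable def zmodCot (N : ℕ) (j : ZMod N) : ℂ := (Real.cot (Real.pi * j.val / N) : ℝ)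

/-- The function `j ↦ tan (π j / N)` on `ZMod N`, evaluated at the representative in `[0, N)`. -/
noncomputable def zmodTan (N : ℕ) (j : ZMod N) : ℂ := (Real.tan (Real.pi * j.val / N) : ℝ)

/-! ### Odd character sums of cotangents and tangents -/

lemma Real.cot_add_int_mul_pi (x : ℝ) (n : ℤ) : Real.cot (x + n * Real.pi) = Real.cot x := by
  rw [← Real.tan_inv_eq_cot, ← Real.tan_inv_eq_cot, Real.tan_add_int_mul_pi]

/-- The conventions `cot 0 = 0` and `tan (π / 2) = 0` make this true without exception. -/
lemma Real.tan_eq_cot_sub_two_mul_cot (x : ℝ) : Real.tan x = Real.cot x - 2 * Real.cot (2 * x) := by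
  rw [Real.cot_eq_cos_div_sin, Real.cot_eq_cos_div_sin, Real.tan_eq_sin_div_cos,
    Real.sin_two_mul, Real.cos_two_mul]
  by_cases hs : Real.sin x = 0
  · simp [hs]
  by_cases hc : Real.cos x = 0
  · simp [hc]
  field_simp
  linear_combination Real.sin_sq_add_cos_sq x

lemma Real.tan_eq_cot_pi_div_two_sub (x : ℝ) : Real.tan x = Real.cot (Real.pi / 2 - x) := by
  rw [Real.cot_eq_cos_div_sin, Real.cos_pi_div_two_sub, Real.sin_pi_div_two_sub,
    Real.tan_eq_sin_div_cos]

lemma exists_eq_val_add (N : ℕ) [NeZero N] (k : ℤ) :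
    ∃ q : ℤ, k = ((k : ZMod N).val : ℤ) + q * N := by
  refine ⟨k / N, ?_⟩
  rw [ZMod.val_intCast]
  exact (Int.emod_add_ediv_mul k N).symm

lemma zmodCot_intCast {N : ℕ} [NeZero N] (k : ℤ) :
    zmodCot N (k : ZMod N) = (Real.cot (Real.pi * k / N) : ℝ) := by
  obtain ⟨q, hq⟩ := exists_eq_val_add N k
  have hN : (N : ℝ) ≠ 0 := NeZero.ne _
  have h : (k : ℝ) = ((k : ZMod N).val : ℝ) + q * N := by exact_mod_cast hq
  rw [zmodCot, ← Real.cot_add_int_mul_pi _ q]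
  congr 2
  rw [h]
  field_simp

lemma zmodTan_intCast {N : ℕ} [NeZero N] (k : ℤ) :
    zmodTan N (k : ZMod N) = (Real.tan (Real.pi * k / N) : ℝ) := by
  obtain ⟨q, hq⟩ := exists_eq_val_add N k
  have hN : (N : ℝ) ≠ 0 := NeZero.ne _
  have h : (k : ℝ) = ((k : ZMod N).val : ℝ) + q * N := by exact_mod_cast hq
  rw [zmodTan, ← Real.tan_add_int_mul_pi _ q]
  congr 2
  rw [h]
  field_simp

lemma hurwitzZetaOdd_toAddCircle_one {N : ℕ} [NeZero N] (j : ZMod N) (hj : j ≠ 0) :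
    HurwitzZeta.hurwitzZetaOdd (ZMod.toAddCircle j) 1 = (Real.pi / 2 : ℝ) * zmodCot N j := by
  have hN : (0 : ℝ) < N := Nat.cast_pos.mpr (NeZero.pos N)
  have hpos : 0 < j.val := Nat.pos_of_ne_zero (by simpa [ZMod.val_eq_zero] using hj)
  rw [ZMod.toAddCircle_apply, hurwitzZetaOdd_one, zmodCot, Complex.ofReal_mul, mul_div_assoc]
  refine ⟨by positivity, ?_⟩
  rw [div_lt_one hN]
  exact_mod_cast j.val_lt

/-- Up to a nonzero factor the sum is `L(1, χ)`. The character need not be primitive. -/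
lemma sum_char_mul_zmodCot_ne_zero {N : ℕ} [NeZero N] {χ : DirichletCharacter ℂ N} (hχ : χ.Odd) :
    ∑ j, χ j * zmodCot N j ≠ 0 := by
  have hne : χ ≠ 1 := by
    rintro rfl
    have : (1 : DirichletCharacter ℂ N) (-1) = 1 := MulChar.one_apply isUnit_one.neg
    rw [hχ] at this
    norm_num at this
  have h0 : χ 0 = 0 := by
    have h : χ (-0) = -χ 0 := DirichletCharacter.Odd.eval_neg χ 0 hχ
    rw [neg_zero] at h
    linear_combination h / 2
  have hL := DirichletCharacter.LFunction_apply_one_ne_zero hne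
  rw [DirichletCharacter.LFunction, ZMod.LFunction_def_odd hχ.to_fun] at hL
  have hs : ∑ j, χ j * HurwitzZeta.hurwitzZetaOdd (ZMod.toAddCircle j) 1 =
      (Real.pi / 2 : ℝ) * ∑ j, χ j * zmodCot N j := by
    rw [Finset.mul_sum]
    refine Finset.sum_congr rfl fun j _ => ?_
    by_cases hj : j = 0
    · simp [hj, h0]
    · rw [hurwitzZetaOdd_toAddCircle_one j hj]
      ring
  rw [hs] at hL
  exact right_ne_zero_of_mul (right_ne_zero_of_mul hL)

lemma sum_char_mul_eq_sum_units {N : ℕ} [NeZero N] (χ : DirichletCharacter ℂ N) (F : ZMod N → ℂ) :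
    ∑ j, χ j * F j = ∑ u : (ZMod N)ˣ, χ u * F u := by
  classical
  symm
  rw [← Finset.sum_image (s := Finset.univ) (g := fun u : (ZMod N)ˣ => (u : ZMod N))
    (f := fun j => χ j * F j) (fun _ _ _ _ h => Units.ext h)]
  refine Finset.sum_subset (Finset.subset_univ _) fun j _ hj => ?_
  rw [MulChar.map_nonunit, zero_mul]
  rintro ⟨u, rfl⟩
  exact hj (Finset.mem_image_of_mem _ (Finset.mem_univ u))

lemma char_mul_sum_units_mul_left {N : ℕ} [NeZero N] (χ : DirichletCharacter ℂ N) (F : ZMod N → ℂ)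
    (v : (ZMod N)ˣ) :
    χ v * ∑ u : (ZMod N)ˣ, χ u * F (v * u) = ∑ u : (ZMod N)ˣ, χ u * F u := by
  rw [← Equiv.sum_comp (Equiv.mulLeft v) fun u : (ZMod N)ˣ => χ u * F u, Finset.mul_sum]
  refine Finset.sum_congr rfl fun u _ => ?_
  rw [Equiv.coe_mulLeft, Units.val_mul, map_mul, mul_assoc]

lemma sum_units_char_mul_zmodCot_ne_zero {N : ℕ} [NeZero N] {χ : DirichletCharacter ℂ N}
    (hχ : χ.Odd) :
    ∑ u : (ZMod N)ˣ, χ u * zmodCot N u ≠ 0 := by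
  rw [← sum_char_mul_eq_sum_units]
  exact sum_char_mul_zmodCot_ne_zero hχ

lemma exists_unit_intCast {N : ℕ} {k : ℤ} (h : IsCoprime k N) : ∃ v : (ZMod N)ˣ, (v : ZMod N) = k :=
  ⟨ZMod.unitOfIsCoprime k h, ZMod.coe_unitOfIsCoprime k h⟩

/-- Here `2` is a unit, and `tan x = cot x - 2 cot (2 x)`. -/
lemma sum_char_mul_zmodTan_ne_zero_of_odd {N : ℕ} [NeZero N] (hN : Odd N)
    {χ : DirichletCharacter ℂ N} (hχ : χ.Odd) :
    ∑ u : (ZMod N)ˣ, χ u * zmodTan N u ≠ 0 := by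
  obtain ⟨v, hv⟩ := exists_unit_intCast (N := N) (k := 2)
    (by simpa using Nat.isCoprime_iff_coprime.mpr (Nat.coprime_two_left.mpr hN))
  have hT (u : (ZMod N)ˣ) : zmodTan N u = zmodCot N u - 2 * zmodCot N (v * u) := by
    have hvu : (v * u : ZMod N) = ((2 * (u : ZMod N).val : ℤ) : ZMod N) := by
      rw [hv]
      push_cast [ZMod.natCast_zmod_val]
      rfl
    rw [hvu, zmodCot_intCast, zmodTan, zmodCot, Real.tan_eq_cot_sub_two_mul_cot,
      Complex.ofReal_sub, Complex.ofReal_mul, Complex.ofReal_ofNat]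
    congr 4
    push_cast
    ring
  have hn : ‖χ v‖ = 1 := χ.unit_norm_eq_one v
  have hS := sum_units_char_mul_zmodCot_ne_zero hχ
  have hv' := char_mul_sum_units_mul_left χ (zmodCot N) v
  simp_rw [hT, mul_sub, Finset.sum_sub_distrib, mul_left_comm _ (2 : ℂ), ← Finset.mul_sum]
  intro h
  -- The sum is `(χ 2 - 2) / χ 2` times the cotangent sum, and `|χ 2| = 1`.
  have h2 : (χ v - 2) * ∑ u : (ZMod N)ˣ, χ u * zmodCot N u = 0 := by
    linear_combination χ v * h + 2 * hv'
  rcases mul_eq_zero.mp h2 with h3 | h3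
  · rw [sub_eq_zero.mp h3] at hn
    norm_num at hn
  · exact hS h3

lemma ZMod.odd_val_of_isUnit {N : ℕ} (hN : 2 ∣ N) (u : (ZMod N)ˣ) : Odd (u : ZMod N).val := by
  have := Nat.Coprime.coprime_dvd_right hN (ZMod.val_coe_unit_coprime u)
  exact Nat.coprime_two_right.mp this

lemma tan_pi_mul_div_eq_cot {M : ℕ} (hM : M ≠ 0) (x : ℝ) :
    Real.tan (Real.pi * x / (2 * M : ℕ)) = Real.cot (Real.pi * (M - x) / (2 * M : ℕ)) := by
  rw [Real.tan_eq_cot_pi_div_two_sub]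
  congr 1
  push_cast
  have : (M : ℝ) ≠ 0 := by exact_mod_cast hM
  field_simp

/-- Here `tan (π c / N) = cot (π (N / 2 - c) / N)`, and `N / 2 - c ≡ (N / 2 - 1) c` for odd `c`,
where `N / 2 - 1` is a unit. -/
lemma sum_char_mul_zmodTan_ne_zero_of_four_dvd {N : ℕ} [NeZero N] (hN : 4 ∣ N)
    {χ : DirichletCharacter ℂ N}
    (hχ : χ.Odd) : ∑ u : (ZMod N)ˣ, χ u * zmodTan N u ≠ 0 := by
  obtain ⟨m, rfl⟩ := hN
  have hm : m ≠ 0 := by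
    rintro rfl
    exact NeZero.ne (4 * 0) rfl
  obtain ⟨v, hv⟩ := exists_unit_intCast (N := 4 * m) (k := 2 * m - 1)
    ⟨2 * m - 1, 1 - m, by push_cast; ring⟩
  have hT (u : (ZMod (4 * m))ˣ) : zmodTan (4 * m) u = zmodCot (4 * m) (v * u) := by
    obtain ⟨c, hc⟩ := ZMod.odd_val_of_isUnit (Dvd.intro (2 * m) (by ring)) u
    have hu : (u : ZMod (4 * m)) = 2 * c + 1 := by
      have := ZMod.natCast_zmod_val (u : ZMod (4 * m))
      rw [hc] at this
      push_cast at this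
      exact this.symm
    have hz : (4 * m : ZMod (4 * m)) = 0 := by
      exact_mod_cast ZMod.natCast_self (4 * m)
    have h1 : (v * u : ZMod (4 * m)) = ((2 * m - (2 * c + 1) : ℤ) : ZMod (4 * m)) := by
      rw [hv, hu]
      push_cast
      linear_combination (c : ZMod (4 * m)) * hz
    have h2 := tan_pi_mul_div_eq_cot (M := 2 * m) (by positivity) (2 * c + 1)
    rw [show 2 * (2 * m) = 4 * m by ring] at h2
    rw [h1, zmodCot_intCast, zmodTan, hc, Complex.ofReal_inj]
    push_cast at h2 ⊢
    rw [h2]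
  simp_rw [hT]
  intro h
  have := char_mul_sum_units_mul_left χ (zmodCot (4 * m)) v
  rw [h, mul_zero] at this
  exact sum_units_char_mul_zmodCot_ne_zero hχ this.symm

/-- Here `χ` comes from a character mod `M`, as reduction mod `M` is bijective on units, and
`tan (π c / (2 M)) = cot (π ((M - c) / 2) / M)` with `(M - c) / 2 ≡ -c / 2` mod `M`. -/
lemma sum_char_mul_zmodTan_ne_zero_of_two_mul {M : ℕ} [NeZero M] (hM : Odd M)
    {χ : DirichletCharacter ℂ (2 * M)} (hχ : χ.Odd) :
    ∑ u : (ZMod (2 * M))ˣ, χ u * zmodTan (2 * M) u ≠ 0 := by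
  have hd : M ∣ 2 * M := Dvd.intro_left 2 rfl
  have hbij : Function.Bijective (ZMod.unitsMap hd) := by
    rw [Fintype.bijective_iff_surjective_and_card]
    refine ⟨ZMod.unitsMap_surjective hd, ?_⟩
    rw [ZMod.card_units_eq_totient, ZMod.card_units_eq_totient,
      Nat.totient_mul (Nat.coprime_two_left.mpr hM), Nat.totient_two, one_mul]
  have hf : χ.FactorsThrough M := by
    rw [DirichletCharacter.factorsThrough_iff_ker_unitsMap hd,
      (MonoidHom.ker_eq_bot_iff _).mpr hbij.1]
    exact bot_le
  obtain ⟨_, ψ, rfl⟩ := hf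
  have hψ : ψ.Odd := by
    have h := DirichletCharacter.changeLevel_eq_cast_of_dvd ψ hd (-1)
    rw [Units.val_neg, Units.val_one, hχ] at h
    rw [DirichletCharacter.Odd, h]
    congr 1
    rw [ZMod.cast_neg hd, ZMod.cast_one hd]
  obtain ⟨v, hv⟩ := exists_unit_intCast (N := M) (k := 2)
    (by simpa using Nat.isCoprime_iff_coprime.mpr (Nat.coprime_two_left.mpr hM))
  have hT (u : (ZMod (2 * M))ˣ) :
      zmodTan (2 * M) u = zmodCot M ((-v⁻¹ : (ZMod M)ˣ) * ZMod.unitsMap hd u) := by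
    obtain ⟨c, hc⟩ := ZMod.odd_val_of_isUnit (Dvd.intro M rfl) u
    obtain ⟨d, hd'⟩ := hM
    have hu : (ZMod.unitsMap hd u : ZMod M) = 2 * c + 1 := by
      rw [ZMod.unitsMap_val]
      have := ZMod.natCast_zmod_val (u : ZMod (2 * M))
      rw [hc] at this
      rw [← this]
      rw [ZMod.cast_natCast hd]
      push_cast
      rfl
    have h1 : ((-v⁻¹ : (ZMod M)ˣ) * ZMod.unitsMap hd u : ZMod M) = ((d - c : ℤ) : ZMod M) := by
      have hz : (2 * d + 1 : ZMod M) = 0 := by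
        have h := congrArg (Nat.cast : ℕ → ZMod M) hd'
        rw [ZMod.natCast_self] at h
        push_cast at h
        exact h.symm
      have hvv : (v : ZMod M) * (v⁻¹ : (ZMod M)ˣ) = 1 := v.mul_inv
      rw [hv] at hvv
      rw [Units.val_neg, hu]
      push_cast at hvv ⊢
      linear_combination (-(v⁻¹ : (ZMod M)ˣ) : ZMod M) * hz + (d - c : ZMod M) * hvv
    have h2 := tan_pi_mul_div_eq_cot (NeZero.ne M) (2 * c + 1)
    rw [h1, zmodCot_intCast, zmodTan, hc, Complex.ofReal_inj]
    push_cast at h2 ⊢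
    rw [h2]
    have hM0 : (M : ℝ) ≠ 0 := NeZero.ne _
    congr 1
    have : (M : ℝ) - (2 * c + 1) = 2 * (d - c) := by
      have : (M : ℝ) = 2 * d + 1 := by exact_mod_cast hd'
      rw [this]; ring
    rw [this]
    field_simp
  have h3 : ∑ u : (ZMod (2 * M))ˣ, DirichletCharacter.changeLevel hd ψ u * zmodTan (2 * M) u =
      ∑ w : (ZMod M)ˣ, ψ w * zmodCot M ((-v⁻¹ : (ZMod M)ˣ) * w) := by
    rw [← Equiv.sum_comp (Equiv.ofBijective _ hbij)]
    refine Finset.sum_congr rfl fun u _ => ?_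
    rw [hT, DirichletCharacter.changeLevel_eq_cast_of_dvd ψ hd, Equiv.ofBijective_apply,
      ZMod.unitsMap_val]
  rw [h3]
  intro h
  have := char_mul_sum_units_mul_left ψ (zmodCot M) (-v⁻¹)
  rw [h, mul_zero] at this
  exact sum_units_char_mul_zmodCot_ne_zero hψ this.symm

lemma sum_char_mul_zmodTan_ne_zero {N : ℕ} [NeZero N] {χ : DirichletCharacter ℂ N} (hχ : χ.Odd) :
    ∑ u : (ZMod N)ˣ, χ u * zmodTan N u ≠ 0 := by
  rcases Nat.even_or_odd N with hN | hN
  · obtain ⟨M, rfl⟩ := hN.two_dvd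
    have hM0 : NeZero M := ⟨by rintro rfl; exact NeZero.ne (2 * 0) rfl⟩
    rcases Nat.even_or_odd M with hM | hM
    · obtain ⟨m, rfl⟩ := hM.two_dvd
      exact sum_char_mul_zmodTan_ne_zero_of_four_dvd ⟨m, by ring⟩ hχ
    · exact sum_char_mul_zmodTan_ne_zero_of_two_mul hM hχ
  · exact sum_char_mul_zmodTan_ne_zero_of_odd hN hχ

/-! ### Separating a relation by characters -/

/-- If no odd character sum of `F` vanishes, then translates of `F` by units that are distinct up to
sign are linearly independent as functions on the units. -/
lemma eq_zero_of_forall_unit_sum_mul_eq_zero {N : ℕ} [NeZero N] {F : ZMod N → ℂ}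
    (hF : ∀ χ : DirichletCharacter ℂ N, χ.Odd → ∑ u : (ZMod N)ˣ, χ u * F u ≠ 0)
    {ι : Type*} [Fintype ι] (w : ι → (ZMod N)ˣ) (hinj : Function.Injective w)
    (hneg : ∀ i j, w i ≠ -w j) (a : ι → ℂ)
    (h : ∀ u : (ZMod N)ˣ, ∑ i, a i * F (w i * u) = 0) (i : ι) : a i = 0 := by
  classical
  have hodd (χ : DirichletCharacter ℂ N) (hχ : χ.Odd) : ∑ i, a i * χ (w i) = 0 := by
    -- The sum of the relations against `χ⁻¹` is a product of `∑ a i * χ (w i)` and a sum of `F`.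
    have hχ' : (χ⁻¹).Odd := by
      rw [DirichletCharacter.Odd, MulChar.inv_apply_eq_inv', hχ]
      norm_num
    refine (mul_eq_zero.mp ?_).resolve_right (hF χ⁻¹ hχ')
    calc (∑ i, a i * χ (w i)) * ∑ u : (ZMod N)ˣ, χ⁻¹ u * F u
        = ∑ i, a i * ∑ u : (ZMod N)ˣ, χ⁻¹ u * F (w i * u) := by
          rw [Finset.sum_mul]
          refine Finset.sum_congr rfl fun i _ => ?_
          rw [← char_mul_sum_units_mul_left χ⁻¹ F (w i), MulChar.inv_apply_eq_inv']
          have : χ (w i) ≠ 0 := ((w i).isUnit.map χ).ne_zero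
          field_simp
      _ = ∑ u : (ZMod N)ˣ, χ⁻¹ u * ∑ i, a i * F (w i * u) := by
          simp_rw [Finset.mul_sum]
          rw [Finset.sum_comm]
          exact Finset.sum_congr rfl fun _ _ => Finset.sum_congr rfl fun _ _ => by ring
      _ = 0 := by simp [h]
  -- Taking the difference of `w j` and `-w j` kills the even characters.
  have hall (χ : DirichletCharacter ℂ N) :
      ∑ j, a j * (χ ((w i : ZMod N)⁻¹) * χ (w j) - χ ((w i : ZMod N)⁻¹) * χ (-w j)) = 0 := by
    rcases χ.even_or_odd with he | ho
    · simp [he.eval_neg]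
    · calc _ = 2 * χ ((w i : ZMod N)⁻¹) * ∑ j, a j * χ (w j) := by
            rw [Finset.mul_sum]
            refine Finset.sum_congr rfl fun j _ => ?_
            rw [ho.eval_neg]
            ring
        _ = 0 := by rw [hodd χ ho, mul_zero]
  have hsum := Finset.sum_eq_zero fun χ (_ : χ ∈ Finset.univ) => hall χ
  rw [Finset.sum_comm] at hsum
  have horth (j : ι) : ∑ χ : DirichletCharacter ℂ N,
      a j * (χ ((w i : ZMod N)⁻¹) * χ (w j) - χ ((w i : ZMod N)⁻¹) * χ (-w j)) =
        if i = j then a j * (N.totient : ℂ) else 0 := by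
    have hn : (w i : ZMod N) ≠ -w j := fun h => hneg i j (Units.ext (by simpa using h))
    have he : (w i : ZMod N) = w j ↔ i = j := by rw [Units.val_inj, hinj.eq_iff]
    rw [← Finset.mul_sum, Finset.sum_sub_distrib,
      DirichletCharacter.sum_char_inv_mul_char_eq ℂ (w i).isUnit,
      DirichletCharacter.sum_char_inv_mul_char_eq ℂ (w i).isUnit, if_neg hn, sub_zero]
    simp only [he, mul_ite, mul_zero]
  simp_rw [horth] at hsum
  rw [Finset.sum_ite_eq, if_pos (Finset.mem_univ _)] at hsum
  refine (mul_eq_zero.mp hsum).resolve_right ?_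
  exact_mod_cast (Nat.totient_pos.mpr (NeZero.pos N)).ne'

/-! ### Star points in the cyclotomic field -/

/-- The root of unity `ζ_N = exp (2 π i / N)`. -/
noncomputable def zetaN (N : ℕ) : ℂ := Complex.exp (2 * (Real.pi : ℂ) * Complex.I / (N : ℂ))

/-- This holds for all `k`: if `2 k ≡ N` mod `2 N`, both sides have the junk value `0`. -/
lemma I_mul_starPoint_eq (N k : ℕ) :
    Complex.I * (starPoint N k : ℂ) = (zetaN N ^ k - 1) / (zetaN N ^ k + 1) := by
  set x : ℂ := ((k * Real.pi / N : ℝ) : ℂ) with hx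
  have hz : zetaN N ^ k = Complex.exp (x * Complex.I) ^ 2 := by
    rw [zetaN, ← Complex.exp_nat_mul, ← Complex.exp_nat_mul, hx]
    congr 1
    push_cast
    ring
  have he : Complex.exp (x * Complex.I) ≠ 0 := Complex.exp_ne_zero _
  rw [hz, starPoint, Complex.ofReal_tan, ← hx, Complex.tan_eq_sin_div_cos, Complex.sin, Complex.cos,
    neg_mul, Complex.exp_neg]
  set e := Complex.exp (x * Complex.I)
  have h1 : e⁻¹ - e = - (e ^ 2 - 1) / e := by field_simp; ring
  have h2 : e + e⁻¹ = (e ^ 2 + 1) / e := by field_simp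
  rw [h1, h2, div_div_div_cancel_right₀ two_ne_zero, neg_div, neg_mul, neg_div, mul_neg,
    div_mul_eq_mul_div, div_div_div_cancel_right₀ he, mul_comm (e ^ 2 - 1), mul_div_assoc,
    ← mul_assoc, Complex.I_mul_I]
  ring

lemma zetaN_isPrimitiveRoot {N : ℕ} [NeZero N] : IsPrimitiveRoot (zetaN N) N :=
  Complex.isPrimitiveRoot_exp N (NeZero.ne N)

lemma zetaN_isIntegral {N : ℕ} [NeZero N] : IsIntegral ℚ (zetaN N) :=
  (zetaN_isPrimitiveRoot.isIntegral (NeZero.pos N)).tower_top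

/-- The Galois conjugation `ζ ↦ ζ ^ c`, as an embedding of `ℚ(ζ)` into `ℂ`. -/
lemma exists_algHom_gen_eq_pow {N : ℕ} [NeZero N] {c : ℕ} (hc : c.Coprime N) :
    ∃ σ : cyclotomicSubfield N →ₐ[ℚ] ℂ,
      σ (IntermediateField.AdjoinSimple.gen ℚ (zetaN N)) = zetaN N ^ c := by
  have hm : zetaN N ^ c ∈ (minpoly ℚ (zetaN N)).aroots ℂ := by
    rw [← Polynomial.cyclotomic_eq_minpoly_rat zetaN_isPrimitiveRoot (NeZero.pos N),
      Polynomial.cyclotomic_eq_minpoly_rat (zetaN_isPrimitiveRoot.pow_of_coprime c hc)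
        (NeZero.pos N), Polynomial.mem_aroots]
    have hi : IsIntegral ℚ (zetaN N ^ c) := zetaN_isIntegral.pow c
    exact ⟨minpoly.ne_zero hi, minpoly.aeval _ _⟩
  exact ⟨(IntermediateField.algHomAdjoinIntegralEquiv ℚ zetaN_isIntegral).symm ⟨_, hm⟩,
    IntermediateField.algHomAdjoinIntegralEquiv_symm_apply_gen ℚ zetaN_isIntegral _⟩

/-- Rational relations between star points are preserved by multiplying all indices by a unit. -/
lemma sum_mul_starPoint_conj {N : ℕ} [NeZero N] {s : Finset ℕ} {a : ℕ → ℚ}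
    (h : ∑ k ∈ s, (a k : ℂ) * (Complex.I * (starPoint N k : ℂ)) = 0) {c : ℕ} (hc : c.Coprime N) :
    ∑ k ∈ s, (a k : ℂ) * (Complex.I * (starPoint N (c * k) : ℂ)) = 0 := by
  obtain ⟨σ, hσ⟩ := exists_algHom_gen_eq_pow hc
  set g : cyclotomicSubfield N := IntermediateField.AdjoinSimple.gen ℚ (zetaN N)
  have hg : (g : ℂ) = zetaN N := IntermediateField.AdjoinSimple.coe_gen ℚ (zetaN N)
  have h0 : ∑ k ∈ s, (a k : cyclotomicSubfield N) * ((g ^ k - 1) / (g ^ k + 1)) = 0 := by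
    apply Subtype.val_injective
    push_cast
    rw [hg, ← h]
    exact Finset.sum_congr rfl fun k _ => by rw [I_mul_starPoint_eq]
  have h1 := congrArg σ h0
  simp only [map_sum, map_mul, map_div₀, map_sub, map_add, map_pow, map_one, map_zero,
    map_ratCast, hσ] at h1
  rw [← h1]
  exact Finset.sum_congr rfl fun k _ => by rw [I_mul_starPoint_eq, pow_mul]

lemma starPoint_eq_zmodTan {N : ℕ} [NeZero N] (k : ℕ) :
    (starPoint N k : ℂ) = zmodTan N (k : ZMod N) := by
  have := zmodTan_intCast (N := N) k
  rw [Int.cast_natCast] at this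
  rw [this, starPoint, Int.cast_natCast, mul_comm Real.pi]

lemma mem_primitiveIndices {N : ℕ} {k : ℕ} :
    k ∈ primitiveIndices N ↔ 1 ≤ k ∧ 2 * k < N ∧ k.Coprime N := by
  simp only [primitiveIndices, starIndices, Finset.mem_filter, Finset.mem_range, Nat.Coprime]
  constructor
  · rintro ⟨⟨_, h1, h2⟩, h3⟩
    exact ⟨h1, h2, h3⟩
  · rintro ⟨h1, h2, h3⟩
    exact ⟨⟨by omega, h1, h2⟩, h3⟩

lemma linearIndependent_I_mul_starPoint {N : ℕ} [NeZero N] :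
    LinearIndependent ℚ (fun k : primitiveIndices N => Complex.I * (starPoint N k : ℂ)) := by
  rw [Fintype.linearIndependent_iff]
  intro a ha i
  have hco (k : primitiveIndices N) : (k : ℕ).Coprime N := (mem_primitiveIndices.mp k.2).2.2
  have hlt (k : primitiveIndices N) : 2 * (k : ℕ) < N := (mem_primitiveIndices.mp k.2).2.1
  have hpos (k : primitiveIndices N) : 1 ≤ (k : ℕ) := (mem_primitiveIndices.mp k.2).1
  set w : primitiveIndices N → (ZMod N)ˣ := fun k => ZMod.unitOfCoprime k (hco k) with hw
  have hval (k : primitiveIndices N) : (w k : ZMod N) = (k : ℕ) := ZMod.coe_unitOfCoprime _ _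
  suffices (a i : ℂ) = 0 by exact_mod_cast this
  refine eq_zero_of_forall_unit_sum_mul_eq_zero (F := zmodTan N)
    (fun χ hχ => sum_char_mul_zmodTan_ne_zero hχ) w ?_ ?_ (fun k => (a k : ℂ)) ?_ i
  · intro k l h
    have h' : ((k : ℕ) : ZMod N) = (l : ℕ) := by rw [← hval, ← hval, h]
    rw [ZMod.natCast_eq_natCast_iff', Nat.mod_eq_of_lt (by linarith [hlt k, hpos k]),
      Nat.mod_eq_of_lt (by linarith [hlt l, hpos l])] at h'
    exact Subtype.ext h'
  · intro k l h
    have h' : ((k + l : ℕ) : ZMod N) = 0 := by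
      rw [Nat.cast_add, ← hval, ← hval, h, Units.val_neg, neg_add_cancel]
    rw [ZMod.natCast_eq_zero_iff] at h'
    have := Nat.le_of_dvd (by linarith [hpos k]) h'
    linarith [hlt k, hlt l]
  · intro u
    set b : ℕ → ℚ := fun k => if h : k ∈ primitiveIndices N then a ⟨k, h⟩ else 0 with hb
    have hba (k : primitiveIndices N) : b k = a k := by simp [hb]
    have h0 : ∑ k ∈ primitiveIndices N, (b k : ℂ) * (Complex.I * (starPoint N k : ℂ)) = 0 := by
      rw [← Finset.sum_coe_sort, ← ha]
      exact Finset.sum_congr rfl fun k _ => by rw [hba, Rat.smul_def]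
    have h1 := sum_mul_starPoint_conj h0 (ZMod.val_coe_unit_coprime u)
    rw [← Finset.sum_coe_sort] at h1
    have h2 : Complex.I * ∑ k, (a k : ℂ) * zmodTan N (w k * u) = 0 := by
      rw [Finset.mul_sum, ← h1]
      refine Finset.sum_congr rfl fun k _ => ?_
      rw [hba, starPoint_eq_zmodTan, hval, Nat.cast_mul, ZMod.natCast_zmod_val,
        mul_comm (u : ZMod N)]
      ring
    exact (mul_eq_zero.mp h2).resolve_left Complex.I_ne_zero

/-! ### The dimension of `ℚ(ζ)⁻` -/

lemma zetaN_mem {N : ℕ} : zetaN N ∈ cyclotomicSubfield N :=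
  IntermediateField.mem_adjoin_simple_self ℚ _

lemma I_mul_starPoint_mem {N : ℕ} (k : ℕ) :
    Complex.I * (starPoint N k : ℂ) ∈ cyclotomicMinus N := by
  refine ⟨?_, starPoint N k, rfl⟩
  rw [I_mul_starPoint_eq]
  have h := pow_mem (zetaN_mem (N := N)) k
  exact div_mem (sub_mem h (one_mem _)) (add_mem h (one_mem _))

lemma finrank_cyclotomicSubfield {N : ℕ} [NeZero N] :
    Module.finrank ℚ (cyclotomicSubfield N) = N.totient := by
  have : Module.finrank ℚ (cyclotomicSubfield N) = (minpoly ℚ (zetaN N)).natDegree :=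
    IntermediateField.adjoin.finrank zetaN_isIntegral
  rw [this, ← Polynomial.cyclotomic_eq_minpoly_rat zetaN_isPrimitiveRoot (NeZero.pos N),
    Polynomial.natDegree_cyclotomic]

lemma cyclotomicMinus_le {N : ℕ} :
    cyclotomicMinus N ≤ Subalgebra.toSubmodule (cyclotomicSubfield N).toSubalgebra :=
  fun _ hz => hz.1

lemma finiteDimensional_cyclotomicSubfield {N : ℕ} [NeZero N] : FiniteDimensional ℚ
    (Subalgebra.toSubmodule (cyclotomicSubfield N).toSubalgebra : Submodule ℚ ℂ) :=
  IntermediateField.adjoin.finiteDimensional (zetaN_isIntegral (N := N))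

lemma finiteDimensional_cyclotomicMinus {N : ℕ} [NeZero N] :
    FiniteDimensional ℚ (cyclotomicMinus N) :=
  have := finiteDimensional_cyclotomicSubfield (N := N)
  Submodule.finiteDimensional_of_le cyclotomicMinus_le

/-- With `α = i s_k ≠ 0`, the spaces `ℚ(ζ)⁻` and `α ℚ(ζ)⁻` consist of imaginary and real elements
of `ℚ(ζ)`, so they are independent, and they have the same dimension. -/
lemma two_mul_finrank_cyclotomicMinus_le {N : ℕ} [NeZero N] {k : ℕ} (hk : starPoint N k ≠ 0) :
    2 * Module.finrank ℚ (cyclotomicMinus N) ≤ N.totient := by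
  let K : Submodule ℚ ℂ := Subalgebra.toSubmodule (cyclotomicSubfield N).toSubalgebra
  have : FiniteDimensional ℚ K := finiteDimensional_cyclotomicSubfield
  have hle : cyclotomicMinus N ≤ K := cyclotomicMinus_le
  set α : ℂ := Complex.I * (starPoint N k : ℂ) with hα
  have hα0 : α ≠ 0 := mul_ne_zero Complex.I_ne_zero (by exact_mod_cast hk)
  let V' : Submodule ℚ ℂ := (cyclotomicMinus N).map (LinearMap.mulLeft ℚ α)
  have hle' : V' ≤ K := by
    rintro _ ⟨z, hz, rfl⟩
    exact (cyclotomicSubfield N).mul_mem (I_mul_starPoint_mem k).1 hz.1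
  have hdisj : cyclotomicMinus N ⊓ V' = ⊥ := by
    rw [eq_bot_iff]
    rintro _ ⟨⟨_, t, rfl⟩, ⟨_, ⟨_, r, rfl⟩, h⟩⟩
    have h' : α * (Complex.I * r) = Complex.I * t := h
    have hre := congrArg Complex.im h'
    have : t = 0 := by simpa [hα] using hre.symm
    simp [this]
  have hfin : FiniteDimensional ℚ (cyclotomicMinus N) := finiteDimensional_cyclotomicMinus
  have hfin' : FiniteDimensional ℚ V' := Submodule.finiteDimensional_of_le hle'
  have hrank : Module.finrank ℚ V' = Module.finrank ℚ (cyclotomicMinus N) :=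
    ((Submodule.equivMapOfInjective (LinearMap.mulLeft ℚ α) (mul_right_injective₀ hα0)
      (cyclotomicMinus N)).finrank_eq).symm
  have hadd := Submodule.finrank_sup_add_finrank_inf_eq (cyclotomicMinus N) V'
  rw [hdisj, finrank_bot, hrank] at hadd
  have hsup : Module.finrank ℚ ↥(cyclotomicMinus N ⊔ V') ≤ Module.finrank ℚ K :=
    Submodule.finrank_mono (sup_le hle hle')
  have hK : Module.finrank ℚ K = N.totient := finrank_cyclotomicSubfield
  omega

/-- Every residue `k < N` prime to `N` is a primitive index or `N` minus one, as `3 ≤ N` excludes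
`k = 0` and `2 k = N`. -/
lemma totient_le_two_mul_card_primitiveIndices {N : ℕ} (hN : 3 ≤ N) :
    N.totient ≤ 2 * (primitiveIndices N).card := by
  have : NeZero N := ⟨by omega⟩
  have hsub : (Finset.range N).filter (fun k => N.Coprime k) ⊆
      primitiveIndices N ∪ (primitiveIndices N).image (N - ·) := by
    intro k hk
    obtain ⟨hkN, hco⟩ := Finset.mem_filter.mp hk
    rw [Finset.mem_range] at hkN
    have hk0 : k ≠ 0 := by
      rintro rfl
      rw [Nat.coprime_zero_right] at hco
      omega
    have hk2 : 2 * k ≠ N := by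
      rintro rfl
      rw [Nat.coprime_mul_iff_left, Nat.coprime_self] at hco
      omega
    rw [Finset.mem_union, Finset.mem_image]
    rcases lt_or_gt_of_ne hk2 with h | h
    · exact Or.inl (mem_primitiveIndices.mpr ⟨by omega, h, hco.symm⟩)
    · refine Or.inr ⟨N - k, mem_primitiveIndices.mpr ⟨by omega, by omega, ?_⟩, by omega⟩
      exact ((Nat.coprime_self_sub_right hkN.le).mpr hco).symm
  rw [Nat.totient_eq_card_coprime]
  have h1 := Finset.card_le_card hsub
  have h2 := Finset.card_union_le (primitiveIndices N) ((primitiveIndices N).image (N - ·))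
  have h3 := Finset.card_image_le (s := primitiveIndices N) (f := (N - ·))
  omega

theorem lemma9 (N : ℕ) (hN : 3 ≤ N) :
    (∀ k ∈ starIndices N, 1 < Nat.gcd k N →
      ∃ a : ℕ → ℚ, starPoint N k = ∑ j ∈ primitiveIndices N, (a j : ℝ) * starPoint N j) ∧
    (∀ k ∈ starIndices N, Complex.I * (starPoint N k : ℂ) ∈ cyclotomicMinus N) ∧
    (∃ b : Module.Basis (primitiveIndices N) ℚ (cyclotomicMinus N),
      ∀ k : primitiveIndices N, (b k : ℂ) = Complex.I * (starPoint N (k : ℕ) : ℂ)) ∧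
    2 * Module.finrank ℚ (cyclotomicMinus N) = Nat.totient N := by
  have : NeZero N := ⟨by omega⟩
  have h1 : 1 ∈ primitiveIndices N :=
    mem_primitiveIndices.mpr ⟨le_rfl, by omega, Nat.coprime_one_left N⟩
  let v : primitiveIndices N → cyclotomicMinus N := fun k =>
    ⟨Complex.I * (starPoint N k : ℂ), I_mul_starPoint_mem _⟩
  have hli : LinearIndependent ℚ v :=
    LinearIndependent.of_comp (cyclotomicMinus N).subtype linearIndependent_I_mul_starPoint
  have hne : starPoint N 1 ≠ 0 := by
    intro h
    apply linearIndependent_I_mul_starPoint.ne_zero ⟨1, h1⟩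
    simp [h]
  have hupper := two_mul_finrank_cyclotomicMinus_le hne
  have hfin : FiniteDimensional ℚ (cyclotomicMinus N) := finiteDimensional_cyclotomicMinus
  have hlower : (primitiveIndices N).card ≤ Module.finrank ℚ (cyclotomicMinus N) := by
    simpa using hli.fintype_card_le_finrank
  have hcard := totient_le_two_mul_card_primitiveIndices hN
  have : Nonempty (primitiveIndices N) := ⟨⟨1, h1⟩⟩
  let b := basisOfLinearIndependentOfCardEqFinrank hli
    (by rw [Fintype.card_coe]; omega)
  have hb (k : primitiveIndices N) : (b k : ℂ) = Complex.I * (starPoint N (k : ℕ) : ℂ) := by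
    simp [b, v]
  refine ⟨fun k _ _ => ?_, fun k _ => I_mul_starPoint_mem k, ⟨b, hb⟩, by omega⟩
  set x : cyclotomicMinus N := ⟨_, I_mul_starPoint_mem k⟩ with hx
  refine ⟨fun j => if h : j ∈ primitiveIndices N then b.repr x ⟨j, h⟩ else 0, ?_⟩
  have hsum := congrArg Subtype.val (b.sum_repr x)
  rw [Submodule.coe_sum] at hsum
  simp only [Submodule.coe_smul, hb, Rat.smul_def, hx, mul_left_comm _ Complex.I] at hsum
  rw [← Finset.mul_sum] at hsum
  have hsum' := mul_left_cancel₀ Complex.I_ne_zero hsum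
  rw [← Finset.sum_coe_sort, ← Complex.ofReal_inj, ← hsum']
  push_cast
  exact Finset.sum_congr rfl fun j _ => by simp [hx]
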